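/- **Conventions.** Fix $d\in\mathbb N$. For $\psi:\mathbb R^d\to[-\infty,+\infty]$ let $\operatorname{dom}\psi=\{x:\psi(x)<+\infty\}$ and $\psi^*(y)=\sup_{x\in\mathbb R^d}\{\langle y,x\rangle-\psi(x)\}$; $\psi$ is proper if $\psi>-\infty$ everywhere and $\operatorname{dom}\psi\neq\emptyset$. A proper convex function $\psi$ is *essentially smooth* if $\operatorname{int}\operatorname{dom}\psi\ne\emptyset$, $\psi$ is differentiable on $\operatorname{int}\operatorname{dom}\psi$, and $\|\nabla\psi(x^k)\|\to\infty$ for every sequence $(x^k)$ in $\operatorname{int}\operatorname{dom}\psi$ that converges to a boundary point of $\operatorname{dom}\psi$. It is *of Legendre type* if, in addition, it is strictly convex on $\operatorname{int}\operatorname{dom}\psi$. For $h$ of Legendre type and $\bar x\in\operatorname{int}\operatorname{dom}h$ let $D_h(u,\bar x)=h(u)-h(\bar x)-\langle\nabla h(\bar x),u-\bar x\rangle$, which is $+\infty$ for $u\notin\operatorname{dom}h$. Let either $\Omega=\mathbb R^d$ with $\nu$ the Lebesgue measure, or $\Omega\subseteq\mathbb R^d$ countable with $\nu$ the counting measure on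 $\Omega$, and let $R$ be a probability measure on $\Omega$ that is absolutely continuous with respect to $\nu$. Its support $\Omega_R$ is the smallest relatively closed subset $A$ of $\Omega$ with $R(\Omega\setminus A)=0$. Let $\Theta_R=\{\theta\in\mathbb R^d:\int_\Omega e^{\langle y,\theta\rangle}\,dR(y)<\infty\}$, and let $\psi_R(\theta)=\log\int_\Omega e^{\langle y,\theta\rangle}\,dR(y)$ for $\theta\in\Theta_R$ and $\psi_R(\theta)=+\infty$ otherwise. **Theorem (well-definedness of the Bregman proximal operator).** Let $h:\mathbb R^d\to(-\infty,+\infty]$ be of Legendre type. Assume that 1. $\operatorname{int}\Theta_R\neq\emptyset$ and $\operatorname{int}\overline{\operatorname{conv}}\,\Omega_R\neq\emptyset$ (minimality), $\psi_R$ is essentially smooth (steepness), and $0\in\operatorname{int}\Theta_R$; 2. either $\Omega_R$ is uncountable, or $\Omega_R$ is countable and $\operatorname{conv}\Omega_R$ is closed; 3. $\operatorname{int}\operatorname{dom}h\cap\operatorname{dom}\psi_R^*\neq\emptyset$. Then, for every $t>0$ and every $\bar x\in\operatorname{int}\operatorname{dom}h$, the set $$\operatorname{prox}^h_{t\psi_R^*}(\bar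 x)=\operatorname*{argmin}\{t\,\psi_R^*(u)+D_h(u,\bar x):u\in\mathbb R^d\}$$ consists of exactly one point, and this point lies in $\operatorname{int}\operatorname{dom}h\cap\operatorname{dom}\psi_R^*$. -/

import Mathlib

open Filter Topology MeasureTheory

noncomputable section

namespace BregmanMEM

/-- The effective domain of an extended-real-valued function. -/
def effDom {X : Type*} (ψ : X → EReal) : Set X := {x | ψ x < ⊤}

/-- A function is proper if it never takes the value `-∞` and is not identically `+∞`. -/
def IsProper {X : Type*} (ψ : X → EReal) : Prop :=
  (∀ x, ⊥ < ψ x) ∧ (effDom ψ).Nonempty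

/-- Convexity of an extended-real-valued function: its epigraph is convex. -/
def IsConvex {X : Type*} [AddCommGroup X] [Module ℝ X] (ψ : X → EReal) : Prop :=
  Convex ℝ {p : X × ℝ | ψ p.1 ≤ (p.2 : EReal)}

/-- The gradient of an extended-real-valued function, which is meant to be used at points around
which the function is finite; there it is the gradient of the real-valued function. -/
def grad {d : ℕ} (ψ : EuclideanSpace ℝ (Fin d) → EReal) (x : EuclideanSpace ℝ (Fin d)) :
    EuclideanSpace ℝ (Fin d) :=
  gradient (fun z => (ψ z).toReal) x

/-- Essentially smooth functions: proper and convex, with a domain that has an interior, on which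
the function is differentiable, and steep at the boundary of the domain. -/
structure IsEssentiallySmooth {d : ℕ} (ψ : EuclideanSpace ℝ (Fin d) → EReal) : Prop where
  proper : IsProper ψ
  convex : IsConvex ψ
  interior_nonempty : (interior (effDom ψ)).Nonempty
  differentiable : ∀ x ∈ interior (effDom ψ), DifferentiableAt ℝ (fun z => (ψ z).toReal) x
  steep : ∀ (u : ℕ → EuclideanSpace ℝ (Fin d)) (x : EuclideanSpace ℝ (Fin d)),
    (∀ k, u k ∈ interior (effDom ψ)) → x ∈ frontier (effDom ψ) → Tendsto u atTop (𝓝 x) →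
      Tendsto (fun k => ‖grad ψ (u k)‖) atTop atTop

/-- Functions of Legendre type: essentially smooth and strictly convex on the interior of the
domain (where the function is finite). -/
structure IsLegendre {d : ℕ} (ψ : EuclideanSpace ℝ (Fin d) → EReal) : Prop
    extends IsEssentiallySmooth ψ where
  strictConvex : StrictConvexOn ℝ (interior (effDom ψ)) (fun z => (ψ z).toReal)

/-- The Fenchel conjugate `ψ^*(y) = sup_x (⟨y, x⟩ - ψ(x))`. -/
def conjugate {d : ℕ} (ψ : EuclideanSpace ℝ (Fin d) → EReal) (y : EuclideanSpace ℝ (Fin d)) :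
    EReal :=
  ⨆ x : EuclideanSpace ℝ (Fin d), ((inner ℝ y x : ℝ) : EReal) - ψ x

/-- The Bregman distance `D_h(y, x) = h(y) - h(x) - ⟨∇h(x), y - x⟩`, meant for `x` in the interior
of the domain of `h`; it is `+∞` for `y` outside the domain of `h`. -/
def bregmanDist {d : ℕ} (h : EuclideanSpace ℝ (Fin d) → EReal) (y x : EuclideanSpace ℝ (Fin d)) :
    EReal :=
  h y - h x - ((inner ℝ (grad h x) (y - x) : ℝ) : EReal)

/-- The set of global minimizers. -/
def argmin {X : Type*} (F : X → EReal) : Set X := {u | ∀ v, F u ≤ F v}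

/-- The Bregman proximal operator
`prox^h_g(x̄) = argmin {g(u) + D_h(u, x̄) : u ∈ ℝ^d}`, as a set of points. -/
def bregmanProx {d : ℕ} (h g : EuclideanSpace ℝ (Fin d) → EReal)
    (xbar : EuclideanSpace ℝ (Fin d)) : Set (EuclideanSpace ℝ (Fin d)) :=
  argmin fun u => g u + bregmanDist h u xbar

/-- The two scenarios for the sample space `Ω` and its dominating measure `ν` (carried by `Ω`):
`Ω = ℝ^d` with the Lebesgue measure, or `Ω` countable with its counting measure. -/
def IsDominating {d : ℕ} (Ω : Set (EuclideanSpace ℝ (Fin d)))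
    (ν : Measure (EuclideanSpace ℝ (Fin d))) : Prop :=
  (Ω = Set.univ ∧ ν = volume) ∨ (Ω.Countable ∧ ν = Measure.count.restrict Ω)

/-- `P ∈ 𝒫(Ω)`: a probability measure on `Ω` that is absolutely continuous with respect to the
dominating measure `ν` of `Ω`. It is regarded as a measure on `ℝ^d` that is carried by `Ω`. -/
structure IsDistribution {d : ℕ} (Ω : Set (EuclideanSpace ℝ (Fin d)))
    (P : Measure (EuclideanSpace ℝ (Fin d))) : Prop where
  isProbabilityMeasure : IsProbabilityMeasure P
  absolutelyContinuous : ∃ ν, IsDominating Ω ν ∧ P ≪ ν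

/-- The support of `P` within `Ω`: the smallest (relatively) closed subset `A` of `Ω` with
`P (Ω \ A) = 0`. -/
def supp {d : ℕ} (Ω : Set (EuclideanSpace ℝ (Fin d)))
    (P : Measure (EuclideanSpace ℝ (Fin d))) : Set (EuclideanSpace ℝ (Fin d)) :=
  Ω ∩ P.support

theorem supp_isLeast {d : ℕ} (Ω : Set (EuclideanSpace ℝ (Fin d)))
    (P : Measure (EuclideanSpace ℝ (Fin d))) (hP : P Ωᶜ = 0) :
    IsLeast {A | (∃ C, IsClosed C ∧ A = Ω ∩ C) ∧ P (Ω \ A) = 0} (supp Ω P) := by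
  refine ⟨⟨⟨P.support, Measure.isClosed_support, rfl⟩, ?_⟩, ?_⟩
  · refine measure_mono_null ?_ (Measure.measure_compl_support (μ := P))
    rintro x ⟨hx, hx'⟩ hxs
    exact hx' ⟨hx, hxs⟩
  · rintro A ⟨⟨C, hC, rfl⟩, hA⟩
    refine Set.inter_subset_inter_right Ω (Measure.support_subset_of_isClosed hC ?_)
    rw [mem_ae_iff]
    refine measure_mono_null (t := Ωᶜ ∪ Ω \ (Ω ∩ C)) ?_ (measure_union_null hP hA)
    intro x hx
    by_cases hxΩ : x ∈ Ω
    · exact Or.inr ⟨hxΩ, fun h => hx h.2⟩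
    · exact Or.inl hxΩ

/-- The convex support: the closed convex hull of the support. -/
def convexSupport {d : ℕ} (Ω : Set (EuclideanSpace ℝ (Fin d)))
    (P : Measure (EuclideanSpace ℝ (Fin d))) : Set (EuclideanSpace ℝ (Fin d)) :=
  closure (convexHull ℝ (supp Ω P))

/-- The natural parameter space `Θ_P = {θ : ∫ exp ⟨y, θ⟩ dP(y) < ∞}`. -/
def naturalParams {d : ℕ} (P : Measure (EuclideanSpace ℝ (Fin d))) :
    Set (EuclideanSpace ℝ (Fin d)) :=
  {θ | ∫⁻ y, ENNReal.ofReal (Real.exp (inner ℝ y θ)) ∂P < ⊤}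

open Classical in
/-- The log-normalizer (cumulant generating function) `ψ_P`. -/
def logNormalizer {d : ℕ} (P : Measure (EuclideanSpace ℝ (Fin d)))
    (θ : EuclideanSpace ℝ (Fin d)) : EReal :=
  if θ ∈ naturalParams P then ((Real.log (∫ y, Real.exp (inner ℝ y θ) ∂P) : ℝ) : EReal) else ⊤

/-- The Cramér rate function `ψ_P^*`. -/
def cramerRate {d : ℕ} (P : Measure (EuclideanSpace ℝ (Fin d))) :
    EuclideanSpace ℝ (Fin d) → EReal :=
  conjugate (logNormalizer P)

/-- The exponential family generated by `P` is minimal: the natural parameter space and the convex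
support are both full-dimensional. -/
def IsMinimal {d : ℕ} (Ω : Set (EuclideanSpace ℝ (Fin d)))
    (P : Measure (EuclideanSpace ℝ (Fin d))) : Prop :=
  (interior (naturalParams P)).Nonempty ∧ (interior (convexSupport Ω P)).Nonempty

/-- The exponential family generated by `P` is steep: its log-normalizer is essentially smooth. -/
def IsSteep {d : ℕ} (P : Measure (EuclideanSpace ℝ (Fin d))) : Prop :=
  IsEssentiallySmooth (logNormalizer P)

/-- The standing assumptions on a reference distribution `P ∈ 𝒫(Ω)`: it generates a minimal and
steep exponential family, `0` is interior to the natural parameter space, and the support is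
either uncountable, or countable with a closed convex hull. -/
structure IsReference {d : ℕ} (Ω : Set (EuclideanSpace ℝ (Fin d)))
    (P : Measure (EuclideanSpace ℝ (Fin d))) : Prop where
  isDistribution : IsDistribution Ω P
  minimal : IsMinimal Ω P
  steep : IsSteep P
  zero_mem : (0 : EuclideanSpace ℝ (Fin d)) ∈ interior (naturalParams P)
  support : ¬ (supp Ω P).Countable ∨
    ((supp Ω P).Countable ∧ IsClosed (convexHull ℝ (supp Ω P)))

end BregmanMEM

end

/-! Up to a constant the objective is `p + f - ⟨a, ·⟩`, with `p = t ψ_R^*`, `f = h` and `a =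
∇h(x̄)`. Since `0 ∈ int Θ_R`, `p` is bounded below and has compact sublevel sets; the tangent
inequality at `x̄` bounds `f - ⟨a, ·⟩` below. A minimizing sequence in `int dom h ∩ dom p` therefore
has a cluster point `u`.

As `h` need not be lower semicontinuous, `f` is replaced in the limit by its tangents at interior
points (`exists_minimizer_of_steep`). The tangent at `u` itself gives minimality if `u` is interior.
If `u` were a boundary point, the derivatives of `f` along a segment entering the domain from `u`
would be unbounded below (`exists_inner_gradient_lt`), so moving inwards would push the objective
below its infimum.

Strict convexity, known only inside `dom h`, still excludes competitors on its boundary, because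
midpoints with `u` are interior (`minimizer_unique`). -/

noncomputable section

namespace BregmanMEM

/-! ### Real-valued convex minimization and steepness -/

section RealValued

variable {E : Type*} [NormedAddCommGroup E] [InnerProductSpace ℝ E]

/-- The gradient inequality for convex functions. -/
theorem add_inner_gradient_le [CompleteSpace E] {C : Set E} {f : E → ℝ} (hf : ConvexOn ℝ C f)
    {x y : E} (hx : x ∈ C) (hy : y ∈ C) (hd : DifferentiableAt ℝ f x) :
    f x + inner ℝ (gradient f x) (y - x) ≤ f y := by
  have hline : ConvexOn ℝ (AffineMap.lineMap x y ⁻¹' C) (f ∘ AffineMap.lineMap (k := ℝ) x y) :=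
    hf.comp_affineMap _
  have h0 : HasFDerivAt f (InnerProductSpace.toDual ℝ E (gradient f x))
      (AffineMap.lineMap x y (0 : ℝ)) := by
    rw [AffineMap.lineMap_apply_zero]
    exact hd.hasGradientAt.hasFDerivAt
  have h1 := h0.comp_hasDerivAt (0 : ℝ) AffineMap.hasDerivAt_lineMap
  have h2 := hline.le_slope_of_hasDerivAt (x := 0) (y := 1) (by simpa) (by simpa) one_pos h1
  have h3 : slope (f ∘ AffineMap.lineMap (k := ℝ) x y) 0 1 = f y - f x := by simp [slope]
  rw [h3, InnerProductSpace.toDual_apply_apply] at h2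
  linarith

/-- For a convex function whose gradient blows up at the boundary of its open domain, the
directional derivatives along a segment that enters the domain from a boundary point are not
bounded below. -/
theorem exists_inner_gradient_lt [CompleteSpace E] {C : Set E} {f : E → ℝ} (hC : IsOpen C)
    (hf : ConvexOn ℝ C f) (hd : ∀ x ∈ C, DifferentiableAt ℝ f x)
    (hsteep : ∀ (u : ℕ → E) (x : E), (∀ k, u k ∈ C) → x ∈ frontier C → Tendsto u atTop (𝓝 x) →
      Tendsto (fun k => ‖gradient f (u k)‖) atTop atTop)
    {u x₀ : E} (hu : u ∈ frontier C) (hx₀ : x₀ ∈ C) (K : ℝ) :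
    ∃ s : ℝ, 0 < s ∧ s < 1 ∧ u + s • (x₀ - u) ∈ C ∧
      inner ℝ (gradient f (u + s • (x₀ - u))) (x₀ - u) < K := by
  have hseg : ∀ s : ℝ, 0 < s → s < 1 → u + s • (x₀ - u) ∈ C := by
    intro s hs0 hs1
    have := hf.1.openSegment_interior_closure_subset_interior
      (by rwa [hC.interior_eq]) (frontier_subset_closure hu)
      (⟨s, 1 - s, hs0, by linarith, by ring, rfl⟩ : s • x₀ + (1 - s) • u ∈ openSegment ℝ x₀ u)
    rw [hC.interior_eq] at this
    convert this using 1
    module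
  by_contra! hcon
  obtain ⟨ε, hε, hball⟩ : ∃ ε > 0, ∀ y, ‖y - x₀‖ ≤ ε → y ∈ C ∧ f y ≤ f x₀ + 1 := by
    have h1 : ∀ᶠ y in 𝓝 x₀, y ∈ C ∧ f y ≤ f x₀ + 1 :=
      Filter.Eventually.and (hC.mem_nhds hx₀) ((hd x₀ hx₀).continuousAt.eventually_le_const (by linarith))
    obtain ⟨ε, hε, h2⟩ := Metric.nhds_basis_closedBall.eventually_iff.1 h1
    exact ⟨ε, hε, fun y hy => h2 (by simpa [dist_eq_norm] using hy)⟩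
  -- If the derivatives stay above `K`, the tangent at a segment point, tested at `x₀ + ε • e` with
  -- `e` the gradient direction, bounds the gradient: `f` is at most `f x₀ + 1` there, and the
  -- tangent at `x₀` bounds `f` below on the segment.
  set B : ℝ := (1 + ‖gradient f x₀‖ * ‖u - x₀‖ + |K|) / ε with hB
  have hbound : ∀ s : ℝ, 0 < s → s < 1 → ‖gradient f (u + s • (x₀ - u))‖ ≤ B := by
    intro s hs0 hs1
    have hxs := hseg s hs0 hs1
    have hK := hcon s hs0 hs1 hxs
    set xs := u + s • (x₀ - u) with hxs_def
    set g := gradient f xs with hg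
    have hlow := add_inner_gradient_le hf hx₀ hxs (hd x₀ hx₀)
    have hxs' : xs - x₀ = (1 - s) • (u - x₀) := by rw [hxs_def]; module
    rw [hxs', inner_smul_right] at hlow
    have hcs := abs_le.1 (abs_real_inner_le_norm (gradient f x₀) (u - x₀))
    obtain ⟨e, hen, heg⟩ : ∃ e : E, ‖e‖ ≤ 1 ∧ inner ℝ g e = ‖g‖ := by
      by_cases hg0 : g = 0
      · exact ⟨0, by simp, by simp [hg0]⟩
      · have : ‖g‖ ≠ 0 := norm_ne_zero_iff.2 hg0
        refine ⟨‖g‖⁻¹ • g, ?_, ?_⟩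
        · simp [norm_smul, this]
        · rw [inner_smul_right, real_inner_self_eq_norm_sq]
          field_simp
    have hy := hball (x₀ + ε • e) (by
      rw [add_sub_cancel_left, norm_smul, Real.norm_of_nonneg hε.le]
      exact mul_le_of_le_one_right hε.le hen)
    have hup := add_inner_gradient_le hf hxs hy.1 (hd xs hxs)
    have hdiff : x₀ + ε • e - xs = (1 - s) • (x₀ - u) + ε • e := by rw [hxs_def]; module
    rw [← hg, hdiff, inner_add_right, inner_smul_right, inner_smul_right, heg] at hup
    rw [hB, le_div_iff₀ hε]
    have hP : 0 ≤ ‖gradient f x₀‖ * ‖u - x₀‖ := by positivity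
    have h1 : -|K| ≤ (1 - s) * inner ℝ g (x₀ - u) := by
      have := mul_le_mul_of_nonneg_left hK (by linarith : 0 ≤ 1 - s)
      have h3 := neg_abs_le K
      nlinarith [abs_nonneg K]
    have h2 : -(‖gradient f x₀‖ * ‖u - x₀‖) ≤ (1 - s) * inner ℝ (gradient f x₀) (u - x₀) := by
      nlinarith [hcs.1]
    linarith [hy.2]
  have hs : ∀ k : ℕ, 0 < 1 / ((k : ℝ) + 2) ∧ 1 / ((k : ℝ) + 2) < 1 := fun k =>
    ⟨by positivity, by rw [div_lt_one (by positivity)]; linarith [(k.cast_nonneg : (0 : ℝ) ≤ k)]⟩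
  have hlim : Tendsto (fun k : ℕ => u + (1 / ((k : ℝ) + 2)) • (x₀ - u)) atTop (𝓝 u) := by
    have h1 : Tendsto (fun k : ℕ => 1 / ((k : ℝ) + 2)) atTop (𝓝 0) :=
      tendsto_const_nhds.div_atTop (tendsto_natCast_atTop_atTop.atTop_add tendsto_const_nhds)
    simpa using (h1.smul_const (x₀ - u)).const_add u
  have htop := hsteep _ u (fun k => hseg _ (hs k).1 (hs k).2) hu hlim
  obtain ⟨k, hk⟩ := (htop.eventually_gt_atTop B).exists
  exact absurd (hbound _ (hs k).1 (hs k).2) (not_le.2 hk)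

/-- The sum of a convex function `p` with compact sublevel sets, of a convex function `f` that is
steep at the boundary of its open domain `C`, and of a linear function attains its minimum in `C`,
as soon as the last two summands are bounded below. -/
theorem exists_minimizer_of_steep [CompleteSpace E] {C D : Set E} {f p : E → ℝ} (hC : IsOpen C)
    (hf : ConvexOn ℝ C f) (hd : ∀ x ∈ C, DifferentiableAt ℝ f x)
    (hsteep : ∀ (u : ℕ → E) (x : E), (∀ k, u k ∈ C) → x ∈ frontier C → Tendsto u atTop (𝓝 x) →
      Tendsto (fun k => ‖gradient f (u k)‖) atTop atTop)
    (hp : ConvexOn ℝ D p) (hcpt : ∀ c, IsCompact {y | y ∈ D ∧ p y ≤ c})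
    {b' : ℝ} (hb' : ∀ y ∈ D, b' ≤ p y) (a : E) {b : ℝ} (hb : ∀ y ∈ C, b ≤ f y - inner ℝ a y)
    (hne : (C ∩ D).Nonempty) :
    ∃ u ∈ C ∩ D, ∀ v ∈ C ∩ D,
      p u + (f u - inner ℝ a u) ≤ p v + (f v - inner ℝ a v) := by
  set G : E → ℝ := fun y => p y + (f y - inner ℝ a y) with hG
  have hbdd : BddBelow (G '' (C ∩ D)) := by
    refine ⟨b' + b, ?_⟩
    rintro _ ⟨y, hy, rfl⟩
    exact add_le_add (hb' y hy.2) (hb y hy.1)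
  set m := sInf (G '' (C ∩ D)) with hm
  have hmle : ∀ y ∈ C ∩ D, m ≤ G y := fun y hy => csInf_le hbdd ⟨y, hy, rfl⟩
  obtain ⟨w, -, hwlim, hw⟩ := exists_seq_tendsto_sInf (hne.image G) hbdd
  choose x hxmem hxw using hw
  obtain ⟨c, hc⟩ := hwlim.bddAbove_range
  have hxK : ∀ k, x k ∈ {y | y ∈ D ∧ p y ≤ c - b} := by
    intro k
    refine ⟨(hxmem k).2, ?_⟩
    have h1 : w k ≤ c := hc ⟨k, rfl⟩
    have h2 := hb _ (hxmem k).1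
    have h3 := hxw k
    simp only [hG] at h3
    linarith
  obtain ⟨u, huK, φ, hφ, hulim⟩ := (hcpt (c - b)).tendsto_subseq hxK
  have huD : u ∈ D := huK.1
  have huC : u ∈ closure C := mem_closure_of_tendsto hulim (.of_forall fun k => (hxmem _).1)
  have hGlim : Tendsto (fun k => G (x (φ k))) atTop (𝓝 m) := by
    simp only [hxw]
    exact hwlim.comp hφ.tendsto_atTop
  -- Limit of the tangent inequality at a fixed `y` along the minimizing sequence; closed sublevel
  -- sets supply the lower semicontinuity of `p`.
  have key : ∀ y ∈ C, p u + (f y + inner ℝ (gradient f y) (u - y) - inner ℝ a u) ≤ m := by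
    intro y hy
    have hlin : Tendsto (fun k => f y + inner ℝ (gradient f y) (x (φ k) - y)
        - inner ℝ a (x (φ k))) atTop
        (𝓝 (f y + inner ℝ (gradient f y) (u - y) - inner ℝ a u)) :=
      ((tendsto_const_nhds.inner (hulim.sub_const y)).const_add _).sub
        (tendsto_const_nhds.inner hulim)
    rw [← le_sub_iff_add_le]
    refine le_of_forall_lt fun c' hc' => ?_
    obtain ⟨c'', hc1, hc2⟩ := exists_between hc'
    refine hc1.trans_le ?_
    rw [le_sub_iff_add_le]
    refine le_of_tendsto_of_tendsto (hlin.const_add c'') hGlim ?_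
    have hev : ∀ᶠ k in atTop, x (φ k) ∉ {y | y ∈ D ∧ p y ≤ c''} :=
      hulim.eventually ((hcpt c'').isClosed.isOpen_compl.mem_nhds fun h => absurd h.2 (not_le.2 hc2))
    filter_upwards [hev] with k hk
    have h1 : c'' < p (x (φ k)) := by
      by_contra! h
      exact hk ⟨(hxmem _).2, h⟩
    have h2 := add_inner_gradient_le hf hy (hxmem (φ k)).1 (hd y hy)
    simp only [hG]
    linarith
  by_cases hu : u ∈ C
  · refine ⟨u, ⟨hu, huD⟩, fun v hv => le_trans ?_ (hmle v hv)⟩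
    simpa using key u hu
  · exfalso
    obtain ⟨x₀, hx₀C, hx₀D⟩ := hne
    have hufr : u ∈ frontier C := by
      rw [hC.frontier_eq]
      exact ⟨huC, hu⟩
    -- Convexity of `p` on the segment, `m ≤ G` and `key` at the same point force the derivative of
    -- `f` towards `x₀` to be at least this threshold.
    obtain ⟨s, hs0, hs1, hsC, hs⟩ := exists_inner_gradient_lt hC hf hd hsteep hufr hx₀C
      (-(p x₀ - p u - inner ℝ a (x₀ - u)))
    have hcomb : u + s • (x₀ - u) = (1 - s) • u + s • x₀ := by module
    have hsD : u + s • (x₀ - u) ∈ D := by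
      rw [hcomb]
      exact hp.1 huD hx₀D (by linarith) hs0.le (by ring)
    have h1 := hmle _ ⟨hsC, hsD⟩
    have h2 : p (u + s • (x₀ - u)) ≤ (1 - s) * p u + s * p x₀ := by
      rw [hcomb]
      exact hp.2 huD hx₀D (by linarith) hs0.le (by ring)
    have h3 := key _ hsC
    have hsub : u - (u + s • (x₀ - u)) = -(s • (x₀ - u)) := by abel
    rw [hsub, inner_neg_right, inner_smul_right] at h3
    simp only [hG] at h1
    rw [inner_add_right a u, inner_smul_right] at h1
    have h4 := mul_lt_mul_of_pos_left hs hs0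
    nlinarith

/-- A minimizer of a convex function over the interior of the domain of a strictly convex summand
is its unique minimizer over the whole domain. -/
theorem minimizer_unique {A C : Set E} {G : E → ℝ} (hG : ConvexOn ℝ A G)
    (hCA : ∀ u ∈ C, ∀ v ∈ A, u ≠ v → midpoint ℝ u v ∈ C) (hC : C ⊆ A)
    (hGs : StrictConvexOn ℝ C G) {u : E} (hu : u ∈ C) (hmin : ∀ v ∈ C, G u ≤ G v)
    {v : E} (hv : v ∈ A) (huv : u ≠ v) : G u < G v := by
  have hmid : ∀ x y : E, midpoint ℝ x y = (1 / 2 : ℝ) • x + (1 / 2 : ℝ) • y := fun x y => by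
    rw [midpoint_eq_smul_add]; norm_num
  set w := midpoint ℝ u v with hw
  have hwC : w ∈ C := hCA u hu v hv huv
  have huw : u ≠ w := fun h => huv ((midpoint_eq_left_iff (R := ℝ)).1 (hw ▸ h.symm))
  have h1 : G w ≤ 1 / 2 * G u + 1 / 2 * G v := by
    rw [hw, hmid]
    exact hG.2 (hC hu) hv (by norm_num) (by norm_num) (by norm_num)
  -- Strictness is used between `u` and the interior point `w`, since `v` may lie outside `C`.
  have h2 : G (midpoint ℝ u w) < 1 / 2 * G u + 1 / 2 * G w := by
    rw [hmid]
    exact hGs.2 hu hwC huw (by norm_num) (by norm_num) (by norm_num)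
  have h3 := hmin _ (hCA u hu w (hC hwC) huw)
  linarith

end RealValued

/-! ### From extended-real to real-valued functions -/

section ExtendedReal

theorem coe_toReal_of_mem_effDom {X : Type*} {ψ : X → EReal} (hψ : ∀ x, ⊥ < ψ x) {x : X}
    (hx : x ∈ effDom ψ) : ((ψ x).toReal : EReal) = ψ x :=
  EReal.coe_toReal (ne_of_lt hx) (hψ x).ne'

theorem eq_top_of_notMem_effDom {X : Type*} {ψ : X → EReal} {x : X} (hx : x ∉ effDom ψ) :
    ψ x = ⊤ :=
  top_le_iff.1 (not_lt.1 hx)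

theorem IsConvex.convexOn_toReal {X : Type*} [AddCommGroup X] [Module ℝ X] {ψ : X → EReal}
    (hc : IsConvex ψ) (hψ : ∀ x, ⊥ < ψ x) :
    ConvexOn ℝ (effDom ψ) (fun x => (ψ x).toReal) := by
  have key : ∀ x ∈ effDom ψ, ∀ y ∈ effDom ψ, ∀ a b : ℝ, 0 ≤ a → 0 ≤ b → a + b = 1 →
      ψ (a • x + b • y) ≤ ((a * (ψ x).toReal + b * (ψ y).toReal : ℝ) : EReal) := by
    intro x hx y hy a b ha hb hab
    have hx' : (x, (ψ x).toReal) ∈ {p : X × ℝ | ψ p.1 ≤ (p.2 : EReal)} :=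
      (coe_toReal_of_mem_effDom hψ hx).ge
    have hy' : (y, (ψ y).toReal) ∈ {p : X × ℝ | ψ p.1 ≤ (p.2 : EReal)} :=
      (coe_toReal_of_mem_effDom hψ hy).ge
    exact hc hx' hy' ha hb hab
  have hconv : Convex ℝ (effDom ψ) := fun x hx y hy a b ha hb hab =>
    (key x hx y hy a b ha hb hab).trans_lt (EReal.coe_lt_top _)
  refine ⟨hconv, fun x hx y hy a b ha hb hab => ?_⟩
  have h1 := key x hx y hy a b ha hb hab
  rw [← coe_toReal_of_mem_effDom hψ (hconv hx hy ha hb hab)] at h1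
  exact EReal.coe_le_coe_iff.1 h1

end ExtendedReal

/-! ### Fenchel conjugates -/

section Conjugate

variable {d : ℕ} {ψ : EuclideanSpace ℝ (Fin d) → EReal}

/-- Exhibits sublevel sets as intersections of half-spaces, whence convexity and closedness. -/
theorem conjugate_le_coe_iff (hψ : ∀ x, ⊥ < ψ x) (y : EuclideanSpace ℝ (Fin d)) (c : ℝ) :
    conjugate ψ y ≤ (c : EReal) ↔ ∀ x ∈ effDom ψ, inner ℝ y x ≤ c + (ψ x).toReal := by
  rw [conjugate, iSup_le_iff]
  refine forall_congr' fun x => ?_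
  by_cases hx : x ∈ effDom ψ
  · rw [← coe_toReal_of_mem_effDom hψ hx, ← EReal.coe_sub, EReal.coe_le_coe_iff]
    simp only [hx, forall_const, EReal.toReal_coe]
    exact sub_le_iff_le_add
  · simp [eq_top_of_notMem_effDom hx, hx]

theorem neg_toReal_le_conjugate (hψ : ∀ x, ⊥ < ψ x) (h0 : 0 ∈ effDom ψ)
    (y : EuclideanSpace ℝ (Fin d)) : ((-(ψ 0).toReal : ℝ) : EReal) ≤ conjugate ψ y := by
  refine le_trans ?_ (le_iSup _ (0 : EuclideanSpace ℝ (Fin d)))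
  rw [← coe_toReal_of_mem_effDom hψ h0, ← EReal.coe_sub, EReal.coe_le_coe_iff]
  simp

theorem isConvex_conjugate (hψ : ∀ x, ⊥ < ψ x) : IsConvex (conjugate ψ) := by
  rintro ⟨y₁, c₁⟩ h₁ ⟨y₂, c₂⟩ h₂ a b ha hb hab
  simp only [Set.mem_ofPred_eq, conjugate_le_coe_iff hψ] at h₁ h₂
  simp only [Set.mem_ofPred_eq, Prod.fst_add, Prod.snd_add, Prod.smul_fst, Prod.smul_snd,
    conjugate_le_coe_iff hψ, smul_eq_mul]
  intro x hx
  have hx1 := mul_le_mul_of_nonneg_left (h₁ x hx) ha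
  have hx2 := mul_le_mul_of_nonneg_left (h₂ x hx) hb
  rw [inner_add_left, real_inner_smul_left, real_inner_smul_left]
  have : (ψ x).toReal = a * (ψ x).toReal + b * (ψ x).toReal := by rw [← add_mul, hab, one_mul]
  linarith

theorem isClosed_conjugate_le (hψ : ∀ x, ⊥ < ψ x) (c : ℝ) :
    IsClosed {y | conjugate ψ y ≤ (c : EReal)} := by
  simp only [conjugate_le_coe_iff hψ, Set.ofPred_forall]
  exact isClosed_biInter fun x _ => isClosed_le (by fun_prop) continuous_const

/-- The sublevel sets of the conjugate of a function that is finite around `0` are compact. -/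
theorem isCompact_conjugate_le (hψ : ∀ x, ⊥ < ψ x) (h0 : 0 ∈ interior (effDom ψ)) (c : ℝ) :
    IsCompact {y | conjugate ψ y ≤ (c : EReal)} := by
  refine Metric.isCompact_of_isClosed_isBounded (isClosed_conjugate_le hψ c) ?_
  obtain ⟨r, hr, hball⟩ := Metric.nhds_basis_closedBall.mem_iff.1 (mem_interior_iff_mem_nhds.1 h0)
  have hcoord : ∀ i : Fin d, ∃ B : ℝ, ∀ y, conjugate ψ y ≤ (c : EReal) → |y i| ≤ B := by
    intro i
    have hmem : ∀ σ : ℝ, |σ| ≤ r → EuclideanSpace.single i σ ∈ effDom ψ := fun σ hσ =>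
      hball (by simpa using hσ)
    -- Testing the supremum at `±r eᵢ` bounds `r * |y i|`.
    refine ⟨(max (c + (ψ (EuclideanSpace.single i r)).toReal)
      (c + (ψ (EuclideanSpace.single i (-r))).toReal)) / r, fun y hy => ?_⟩
    rw [conjugate_le_coe_iff hψ] at hy
    have h1 := hy _ (hmem r (abs_of_pos hr).le)
    have h2 := hy _ (hmem (-r) (by rw [abs_neg, abs_of_pos hr]))
    rw [EuclideanSpace.inner_single_right] at h1 h2
    simp only [conj_trivial] at h1 h2
    rw [le_div_iff₀ hr, ← abs_of_pos hr, ← abs_mul, abs_of_pos hr]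
    exact abs_le'.2 ⟨le_max_of_le_left (by linarith), le_max_of_le_right (by linarith)⟩
  choose B hB using hcoord
  refine isBounded_iff_forall_norm_le.2 ⟨∑ i, B i, fun y hy => ?_⟩
  calc ‖y‖ = ‖∑ i, EuclideanSpace.single i (y i)‖ := by
        congr 1
        ext j
        simp [Finset.sum_apply]
    _ ≤ ∑ i, ‖EuclideanSpace.single i (y i)‖ := norm_sum_le _ _
    _ ≤ ∑ i, B i := Finset.sum_le_sum fun i _ => by simpa using hB i y hy

end Conjugate

theorem bot_lt_logNormalizer {d : ℕ} (P : Measure (EuclideanSpace ℝ (Fin d)))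
    (θ : EuclideanSpace ℝ (Fin d)) : ⊥ < logNormalizer P θ := by
  unfold logNormalizer
  split_ifs
  exacts [EReal.bot_lt_coe _, bot_lt_top]

theorem effDom_logNormalizer {d : ℕ} (P : Measure (EuclideanSpace ℝ (Fin d))) :
    effDom (logNormalizer P) = naturalParams P := by
  ext θ
  simp only [effDom, Set.mem_ofPred_eq, logNormalizer]
  split_ifs with hθ <;> simp [hθ, EReal.coe_lt_top]

/-- The Bregman proximal operator of a proper convex function with compact sublevel sets with
respect to a Legendre kernel is single-valued, with values in the interior of the domain of the
kernel. -/
theorem exists_bregmanProx_eq_singleton {d : ℕ} {h g : EuclideanSpace ℝ (Fin d) → EReal}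
    (hh : IsLegendre h) {b' : ℝ} (hb' : ∀ y, (b' : EReal) ≤ g y) (hg : IsConvex g)
    (hcpt : ∀ c : ℝ, IsCompact {y | g y ≤ (c : EReal)})
    (hdom : (interior (effDom h) ∩ effDom g).Nonempty)
    {xbar : EuclideanSpace ℝ (Fin d)} (hxbar : xbar ∈ interior (effDom h)) :
    ∃ xplus ∈ interior (effDom h) ∩ effDom g, bregmanProx h g xbar = {xplus} := by
  have hh' := hh.proper.1
  have hg' : ∀ y, ⊥ < g y := fun y => (EReal.bot_lt_coe b').trans_le (hb' y)
  have hC := isOpen_interior (s := effDom h)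
  have hhconv := hh.convex.convexOn_toReal hh'
  have hf := hh.strictConvex.convexOn
  have hgconv := hg.convexOn_toReal hg'
  set p : EuclideanSpace ℝ (Fin d) → ℝ := fun y => (g y).toReal with hp
  set f : EuclideanSpace ℝ (Fin d) → ℝ := fun y => (h y).toReal with hfdef
  set a := grad h xbar with ha
  have hagrad : a = gradient f xbar := rfl
  have hcpt' : ∀ c, IsCompact {y | y ∈ effDom g ∧ p y ≤ c} := by
    intro c
    convert hcpt c using 1
    ext y
    constructor
    · rintro ⟨hy, hc⟩
      exact (coe_toReal_of_mem_effDom hg' hy).symm.trans_le (EReal.coe_le_coe_iff.2 hc)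
    · intro hc
      have hy : y ∈ effDom g := lt_of_le_of_lt hc (EReal.coe_lt_top c)
      refine ⟨hy, EReal.coe_le_coe_iff.1 ?_⟩
      exact (coe_toReal_of_mem_effDom hg' hy).trans_le hc
  have hbp : ∀ y ∈ effDom g, b' ≤ p y := fun y hy =>
    EReal.coe_le_coe_iff.1 ((hb' y).trans (coe_toReal_of_mem_effDom hg' hy).ge)
  obtain ⟨u, huCD, hmin⟩ := exists_minimizer_of_steep hC hf hh.differentiable
    (fun v x hv hx hlim => hh.steep v x hv (frontier_interior_subset hx) hlim) hgconv hcpt' hbp a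
    -- The tangent inequality at `xbar`, i.e. nonnegativity of the Bregman distance.
    (b := f xbar - inner ℝ a xbar)
    (fun y hy => by
      have h1 := add_inner_gradient_le hf hxbar hy (hh.differentiable _ hxbar)
      rw [← hagrad, inner_sub_right] at h1
      linarith) hdom
  set G : EuclideanSpace ℝ (Fin d) → ℝ := fun v => p v + (f v - inner ℝ a v) with hG
  have hGeq : G = p + (f + fun v => -inner ℝ a v) :=
    funext fun v => by simp only [hG, Pi.add_apply, sub_eq_add_neg]
  have hlin : ∀ s : Set (EuclideanSpace ℝ (Fin d)), Convex ℝ s →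
      ConvexOn ℝ s (fun v => -inner ℝ a v) := fun s hs =>
    ⟨hs, fun x _ y _ r q _ _ _ => by
      simp only [inner_add_right, inner_smul_right, smul_eq_mul]
      linarith⟩
  have hA : Convex ℝ (effDom h ∩ effDom g) := hhconv.1.inter hgconv.1
  have hI : Convex ℝ (interior (effDom h) ∩ effDom g) := hf.1.inter hgconv.1
  have hGconv : ConvexOn ℝ (effDom h ∩ effDom g) G := by
    have := (hgconv.subset Set.inter_subset_right hA).add
      ((hhconv.subset Set.inter_subset_left hA).add (hlin _ hA))
    rw [hGeq]
    exact this
  have hGstrict : StrictConvexOn ℝ (interior (effDom h) ∩ effDom g) G := by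
    have := (hgconv.subset Set.inter_subset_right hI).add_strictConvexOn
      ((hh.strictConvex.subset Set.inter_subset_left hI).add_convexOn (hlin _ hI))
    rw [hGeq]
    exact this
  have hmid : ∀ u ∈ interior (effDom h) ∩ effDom g, ∀ v ∈ effDom h ∩ effDom g, u ≠ v →
      midpoint ℝ u v ∈ interior (effDom h) ∩ effDom g := fun u hu v hv huv =>
    ⟨hhconv.1.openSegment_interior_self_subset_interior hu.1 hv.1
      (midpoint_mem_openSegment u v), hgconv.1.segment_subset hu.2 hv.2 (midpoint_mem_segment u v)⟩
  have huniq : ∀ v ∈ effDom h ∩ effDom g, u ≠ v → G u < G v := fun v hv huv =>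
    minimizer_unique hGconv hmid (Set.inter_subset_inter_left _ interior_subset) hGstrict huCD
      hmin hv huv
  set F : EuclideanSpace ℝ (Fin d) → EReal := fun v => g v + bregmanDist h v xbar with hF
  have hxbar' := coe_toReal_of_mem_effDom hh' (interior_subset hxbar)
  have hFcoe : ∀ v ∈ effDom h ∩ effDom g,
      F v = ((G v + (inner ℝ a xbar - f xbar) : ℝ) : EReal) := by
    intro v hv
    simp only [hF, bregmanDist, ← ha]
    rw [← hxbar', ← coe_toReal_of_mem_effDom hh' hv.1, ← coe_toReal_of_mem_effDom hg' hv.2,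
      ← EReal.coe_sub, ← EReal.coe_sub, ← EReal.coe_add]
    congr 1
    rw [inner_sub_right]
    simp only [hG, hp, hfdef]
    ring
  -- Since `⊥ + ⊤ = ⊥` in `EReal`, this needs `g` to avoid `⊥`.
  have hFtop : ∀ v, v ∉ effDom h ∩ effDom g → F v = ⊤ := by
    intro v hv
    simp only [hF, bregmanDist]
    rw [← hxbar']
    by_cases hvh : v ∈ effDom h
    · have hvg : v ∉ effDom g := fun hvg => hv ⟨hvh, hvg⟩
      rw [eq_top_of_notMem_effDom hvg, ← coe_toReal_of_mem_effDom hh' hvh, ← EReal.coe_sub,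
        ← EReal.coe_sub, EReal.top_add_coe]
    · rw [eq_top_of_notMem_effDom hvh, EReal.top_sub_coe, EReal.top_sub_coe,
        EReal.add_top_of_ne_bot (hg' v).ne']
  have huA : u ∈ effDom h ∩ effDom g := ⟨interior_subset huCD.1, huCD.2⟩
  have hlt : ∀ v, u ≠ v → F u < F v := by
    intro v huv
    rw [hFcoe u huA]
    by_cases hv : v ∈ effDom h ∩ effDom g
    · rw [hFcoe v hv, EReal.coe_lt_coe_iff]
      linarith [huniq v hv huv]
    · rw [hFtop v hv]
      exact EReal.coe_lt_top _
  refine ⟨u, huCD, Set.eq_singleton_iff_unique_mem.2 ⟨fun v => ?_, fun v hv => ?_⟩⟩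
  · by_cases huv : u = v
    · rw [huv]
    · exact (hlt v huv).le
  · by_contra huv
    exact absurd (hv u) (not_le.2 (hlt v (Ne.symm huv)))

/-! ### Positive multiples of extended-real functions -/

section PosMul

variable {X : Type*} {g : X → EReal} {t : ℝ}

theorem coe_mul_le_coe_iff (ht : 0 < t) (z : EReal) (c : ℝ) :
    (t : EReal) * z ≤ (c : EReal) ↔ z ≤ ((c / t : ℝ) : EReal) := by
  induction z with
  | bot => simp [EReal.coe_mul_bot_of_pos ht]
  | top => simp [EReal.coe_mul_top_of_pos ht]
  | coe r => rw [← EReal.coe_mul, EReal.coe_le_coe_iff, EReal.coe_le_coe_iff, le_div_iff₀' ht]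

theorem effDom_coe_mul (ht : 0 < t) : effDom (fun x => (t : EReal) * g x) = effDom g := by
  ext x
  simp only [effDom, Set.mem_ofPred_eq]
  induction g x with
  | bot => simp [EReal.coe_mul_bot_of_pos ht]
  | top => simp [EReal.coe_mul_top_of_pos ht]
  | coe r => simp [← EReal.coe_mul, EReal.coe_lt_top]

theorem IsConvex.coe_mul [AddCommGroup X] [Module ℝ X] (hg : IsConvex g) (ht : 0 < t) :
    IsConvex (fun x => (t : EReal) * g x) := by
  rintro ⟨y₁, c₁⟩ h₁ ⟨y₂, c₂⟩ h₂ a b ha hb hab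
  simp only [Set.mem_ofPred_eq, coe_mul_le_coe_iff ht] at h₁ h₂ ⊢
  have h := hg (x := (y₁, c₁ / t)) h₁ (y := (y₂, c₂ / t)) h₂ ha hb hab
  have hc : (a * c₁ + b * c₂) / t = a * (c₁ / t) + b * (c₂ / t) := by ring
  simp only [Prod.snd_add, Prod.smul_snd, smul_eq_mul, hc]
  exact h

end PosMul

end BregmanMEM

end

theorem mainTheorem7 {d : ℕ} (h : EuclideanSpace ℝ (Fin d) → EReal)
    (hh : BregmanMEM.IsLegendre h)
    (Ω : Set (EuclideanSpace ℝ (Fin d)))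
    (R : MeasureTheory.Measure (EuclideanSpace ℝ (Fin d)))
    (hR : BregmanMEM.IsReference Ω R)
    (hdom : (interior (BregmanMEM.effDom h) ∩
      BregmanMEM.effDom (BregmanMEM.cramerRate R)).Nonempty)
    (t : ℝ) (ht : 0 < t)
    (xbar : EuclideanSpace ℝ (Fin d)) (hxbar : xbar ∈ interior (BregmanMEM.effDom h)) :
    ∃ xplus ∈ interior (BregmanMEM.effDom h) ∩ BregmanMEM.effDom (BregmanMEM.cramerRate R),
      BregmanMEM.bregmanProx h (fun u => (t : EReal) * BregmanMEM.cramerRate R u) xbar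
        = {xplus} := by
  have hψ := BregmanMEM.bot_lt_logNormalizer R
  have h0 : 0 ∈ interior (BregmanMEM.effDom (BregmanMEM.logNormalizer R)) := by
    rw [BregmanMEM.effDom_logNormalizer]
    exact hR.zero_mem
  have hlow : ∀ y, ((t * -(BregmanMEM.logNormalizer R 0).toReal : ℝ) : EReal) ≤
      (t : EReal) * BregmanMEM.cramerRate R y := fun y => by
    rw [EReal.coe_mul]
    exact mul_le_mul_of_nonneg_left
      (BregmanMEM.neg_toReal_le_conjugate hψ (interior_subset h0) y) (EReal.coe_nonneg.2 ht.le)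
  rw [← BregmanMEM.effDom_coe_mul (g := BregmanMEM.cramerRate R) ht] at hdom ⊢
  refine BregmanMEM.exists_bregmanProx_eq_singleton hh hlow
    ((BregmanMEM.isConvex_conjugate hψ).coe_mul ht) (fun c => ?_) hdom hxbar
  simp only [BregmanMEM.coe_mul_le_coe_iff ht]
  exact BregmanMEM.isCompact_conjugate_le hψ h0 _
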